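/- Consider the second-order language with individual variables $x_i$ ($i\ge 0$), $n$-ary predicate variables $A_i^n$ ($n\ge 1$, $i\ge 0$), identity between variables of the same sort, the connectives $\neg,\land,\lor,\to,\leftrightarrow$ and quantifiers over both kinds of variables, a variable being quantified only if it does not already occur bound in the scope. A predicate structure $(J_n)_{n\ge 0}$ consists of a non-empty set $J_0$ of individuals and, for each $n\ge 1$, a non-empty set $J_n$ of $n$-ary predicates on $J_0$; individual variables range over $J_0$ and $n$-ary predicate variables over $J_n$, and a structure is a model of a set of formulas if each of them is true under every assignment. Let ${}^{h}ax^{(2)}$ consist of the propositional tautologies of the language, the identity axioms (reflexivity and Leibniz' schema, for individual and for predicate variables), the extensionality axioms $\forall\mathbf x(A\mathbf x\leftrightarrow B\mathbf x)\to A=B$, and the comprehension axioms $\exists A\,\forall\mathbf x(A\mathbf x\leftrightarrow H(\mathbf x))$, where $H$ is any formula in which the variables $\mathbf x$ do not occur bound and $A$ does not occur (other free variables are allowed). A Henkin–Asser structure is a predicate structure that is a model of all comprehension axioms. For $n,m\ge 1$ let $choice_h^{n,m}$ be the set of all formulas \[\forall\mathbf x\,\exists D\,H(\mathbf x,D)\;\to\;\exists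 S\,\forall\mathbf x\,\exists D\bigl(\forall\mathbf y(D\mathbf y\leftrightarrow S\mathbf x\mathbf y)\land H(\mathbf x,D)\bigr),\] where $\mathbf x$, $\mathbf y$ are lists of $n$ and $m$ pairwise distinct individual variables, $D$ and $S$ are predicate variables of arity $m$ and $n+m$, and $H$ is any formula in which the variables $\mathbf x$ and $D$ do not occur bound and $S$ does not occur (other free variables are allowed). Let $WO^1$ be the formula $\forall A\,\exists T\, wo(T,A)$ with $A$ unary and $T$ binary, where $wo(T,A)$ says that $T$ is a linear ordering of $A$ and that every non-empty unary predicate $B\subseteq A$ (in the structure) has a $T$-least element. For an infinite set $I$, let the basic second-order Fraenkel model $\Sigma_0$ over $I$ be the predicate structure with $J_0=I$ in which $J_n$ ($n\ge 1$) consists of all $n$-ary predicates $\alpha$ on $I$ for which there is a finite set $P\subseteq I$ such that $\alpha$ is invariant under all permutations of $I$ that fix each element of $P$. Then, for every infinite set $I$, $\Sigma_0$ is a Henkin–Asser structure, and it is a model of \[{}^{h}ax^{(2)}\cup choice_h^{n,m}\cup\{\neg WO^1\}\] for all $n\ge 1$ and $m\ge 1$. In particular, there is a Henkin–Asser structure that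 is a model of these sets for all $n,m\ge 1$. -/

import Mathlib

/-! Second-order predicate logic with Henkin interpretation (HPL): language, predicate structures,
axioms, the choice schema, the well-ordering principle, and the basic Fraenkel model. -/

universe u

namespace HPL

/-! ### The language -/

/-- Raw formulas. `x_i` (`i : ℕ`) are the individual variables, and `A_i^n` (`n ≥ 1`, `i : ℕ`) the
`n`-ary predicate variables. `app n i x` is the atomic formula `A_i^n x_1 ... x_n`. The formulas of
the logic are the members of `L2` below. -/
inductive Formula : Type
  | app (n : ℕ+) (i : ℕ) (x : Fin n → ℕ)
  | eqInd (i j : ℕ)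
  | eqPred (n : ℕ+) (i j : ℕ)
  | neg (H : Formula)
  | and (H₁ H₂ : Formula)
  | or (H₁ H₂ : Formula)
  | imp (H₁ H₂ : Formula)
  | iff (H₁ H₂ : Formula)
  | allInd (i : ℕ) (H : Formula)
  | exInd (i : ℕ) (H : Formula)
  | allPred (n : ℕ+) (i : ℕ) (H : Formula)
  | exPred (n : ℕ+) (i : ℕ) (H : Formula)

namespace Formula

/-- The individual variable `x_k` occurs bound in the formula. -/
def BoundInd (k : ℕ) : Formula → Prop
  | app _ _ _ => False
  | eqInd _ _ => False
  | eqPred _ _ _ => False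
  | neg H => BoundInd k H
  | and H₁ H₂ => BoundInd k H₁ ∨ BoundInd k H₂
  | or H₁ H₂ => BoundInd k H₁ ∨ BoundInd k H₂
  | imp H₁ H₂ => BoundInd k H₁ ∨ BoundInd k H₂
  | iff H₁ H₂ => BoundInd k H₁ ∨ BoundInd k H₂
  | allInd i H => k = i ∨ BoundInd k H
  | exInd i H => k = i ∨ BoundInd k H
  | allPred _ _ H => BoundInd k H
  | exPred _ _ H => BoundInd k H

/-- The predicate variable `A_k^m` occurs bound in the formula. -/
def BoundPred (m : ℕ+) (k : ℕ) : Formula → Prop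
  | app _ _ _ => False
  | eqInd _ _ => False
  | eqPred _ _ _ => False
  | neg H => BoundPred m k H
  | and H₁ H₂ => BoundPred m k H₁ ∨ BoundPred m k H₂
  | or H₁ H₂ => BoundPred m k H₁ ∨ BoundPred m k H₂
  | imp H₁ H₂ => BoundPred m k H₁ ∨ BoundPred m k H₂
  | iff H₁ H₂ => BoundPred m k H₁ ∨ BoundPred m k H₂
  | allInd _ H => BoundPred m k H
  | exInd _ H => BoundPred m k H
  | allPred n i H => (m = n ∧ k = i) ∨ BoundPred m k H
  | exPred n i H => (m = n ∧ k = i) ∨ BoundPred m k H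

/-- The predicate variable `A_k^m` occurs, free or bound, in the formula. -/
def OccursPred (m : ℕ+) (k : ℕ) : Formula → Prop
  | app n i _ => m = n ∧ k = i
  | eqInd _ _ => False
  | eqPred n i j => m = n ∧ (k = i ∨ k = j)
  | neg H => OccursPred m k H
  | and H₁ H₂ => OccursPred m k H₁ ∨ OccursPred m k H₂
  | or H₁ H₂ => OccursPred m k H₁ ∨ OccursPred m k H₂
  | imp H₁ H₂ => OccursPred m k H₁ ∨ OccursPred m k H₂
  | iff H₁ H₂ => OccursPred m k H₁ ∨ OccursPred m k H₂
  | allInd _ H => OccursPred m k H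
  | exInd _ H => OccursPred m k H
  | allPred n i H => (m = n ∧ k = i) ∨ OccursPred m k H
  | exPred n i H => (m = n ∧ k = i) ∨ OccursPred m k H

/-- Well-formedness: a variable may be quantified only if it does not occur bound in the scope. -/
def WF : Formula → Prop
  | app _ _ _ => True
  | eqInd _ _ => True
  | eqPred _ _ _ => True
  | neg H => WF H
  | and H₁ H₂ => WF H₁ ∧ WF H₂
  | or H₁ H₂ => WF H₁ ∧ WF H₂
  | imp H₁ H₂ => WF H₁ ∧ WF H₂
  | iff H₁ H₂ => WF H₁ ∧ WF H₂
  | allInd i H => WF H ∧ ¬ BoundInd i H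
  | exInd i H => WF H ∧ ¬ BoundInd i H
  | allPred n i H => WF H ∧ ¬ BoundPred n i H
  | exPred n i H => WF H ∧ ¬ BoundPred n i H

/-- Replacement of all free occurrences of the individual variable `x_i` by `x_j`. -/
def substInd (i j : ℕ) : Formula → Formula
  | app n k x => app n k (fun l => if x l = i then j else x l)
  | eqInd k l => eqInd (if k = i then j else k) (if l = i then j else l)
  | eqPred n k l => eqPred n k l
  | neg H => neg (substInd i j H)
  | and H₁ H₂ => and (substInd i j H₁) (substInd i j H₂)
  | or H₁ H₂ => or (substInd i j H₁) (substInd i j H₂)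
  | imp H₁ H₂ => imp (substInd i j H₁) (substInd i j H₂)
  | iff H₁ H₂ => iff (substInd i j H₁) (substInd i j H₂)
  | allInd k H => if k = i then allInd k H else allInd k (substInd i j H)
  | exInd k H => if k = i then exInd k H else exInd k (substInd i j H)
  | allPred n k H => allPred n k (substInd i j H)
  | exPred n k H => exPred n k (substInd i j H)

/-- Replacement of all free occurrences of the predicate variable `A_i^m` by `A_j^m`. -/
def substPred (m : ℕ+) (i j : ℕ) : Formula → Formula
  | app n k x => app n (if n = m ∧ k = i then j else k) x
  | eqInd k l => eqInd k l
  | eqPred n k l =>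
      eqPred n (if n = m ∧ k = i then j else k) (if n = m ∧ l = i then j else l)
  | neg H => neg (substPred m i j H)
  | and H₁ H₂ => and (substPred m i j H₁) (substPred m i j H₂)
  | or H₁ H₂ => or (substPred m i j H₁) (substPred m i j H₂)
  | imp H₁ H₂ => imp (substPred m i j H₁) (substPred m i j H₂)
  | iff H₁ H₂ => iff (substPred m i j H₁) (substPred m i j H₂)
  | allInd k H => allInd k (substPred m i j H)
  | exInd k H => exInd k (substPred m i j H)
  | allPred n k H => if n = m ∧ k = i then allPred n k H else allPred n k (substPred m i j H)
  | exPred n k H => if n = m ∧ k = i then exPred n k H else exPred n k (substPred m i j H)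

/-- `∀ x_1 ... ∀ x_n H` for a tuple of individual variables. -/
def allTuple {n : ℕ} (x : Fin n → ℕ) (H : Formula) : Formula :=
  (List.ofFn x).foldr allInd H

end Formula

/-- The set of all second-order formulas. -/
def L2 : Set Formula := {H | H.WF}

/-! ### Predicate structures and truth -/

/-- The `n`-ary predicates on `I`. -/
abbrev Pred (I : Type u) (n : ℕ) : Type u := (Fin n → I) → Prop

/-- A predicate structure `(J_n)_{n ≥ 0}`: a non-empty domain `J₀` of individuals and, for each
`n ≥ 1`, a non-empty set `J n` of `n`-ary predicates on `J₀`. -/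
structure PredicateStructure : Type (u + 1) where
  J₀ : Type u
  nonempty_ind : Nonempty J₀
  J : (n : ℕ+) → Set (Pred J₀ n)
  nonempty_pred : ∀ n, (J n).Nonempty

/-- Assignments in a predicate structure. -/
structure Assignment (M : PredicateStructure.{u}) where
  ind : ℕ → M.J₀
  pred : (v : ℕ+ × ℕ) → M.J v.1

namespace Assignment

variable {M : PredicateStructure.{u}}

/-- The assignment that maps `x_i` to `ξ` and otherwise agrees with `f`. -/
def setInd (f : Assignment M) (i : ℕ) (ξ : M.J₀) : Assignment M :=
  { f with ind := Function.update f.ind i ξ }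

/-- The assignment that maps `A_i^n` to `α` and otherwise agrees with `f`. -/
def setPred (f : Assignment M) (n : ℕ+) (i : ℕ) (α : M.J n) : Assignment M :=
  { f with pred := Function.update f.pred (n, i) α }

end Assignment

/-- `Holds M H f`: the formula `H` is true in `M` under the assignment `f`. -/
def Holds (M : PredicateStructure.{u}) : Formula → Assignment M → Prop
  | .app n i x, f => (f.pred (n, i)).1 (fun k => f.ind (x k))
  | .eqInd i j, f => f.ind i = f.ind j
  | .eqPred n i j, f => f.pred (n, i) = f.pred (n, j)
  | .neg H, f => ¬ Holds M H f
  | .and H₁ H₂, f => Holds M H₁ f ∧ Holds M H₂ f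
  | .or H₁ H₂, f => Holds M H₁ f ∨ Holds M H₂ f
  | .imp H₁ H₂, f => Holds M H₁ f → Holds M H₂ f
  | .iff H₁ H₂, f => (Holds M H₁ f ↔ Holds M H₂ f)
  | .allInd i H, f => ∀ ξ : M.J₀, Holds M H (f.setInd i ξ)
  | .exInd i H, f => ∃ ξ : M.J₀, Holds M H (f.setInd i ξ)
  | .allPred n i H, f => ∀ α : M.J n, Holds M H (f.setPred n i α)
  | .exPred n i H, f => ∃ α : M.J n, Holds M H (f.setPred n i α)

/-- `M` is a model of the set `G` of formulas: each member is true under every assignment. -/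
def Models (M : PredicateStructure.{u}) (G : Set Formula) : Prop :=
  ∀ H ∈ G, ∀ f : Assignment M, Holds M H f

/-! ### The axioms of HPL -/

/-- A truth valuation of all formulas that respects the propositional connectives (and treats all
other formulas as propositional atoms). -/
structure IsPropValuation (v : Formula → Prop) : Prop where
  neg : ∀ H, v (.neg H) ↔ ¬ v H
  and : ∀ H₁ H₂, v (.and H₁ H₂) ↔ (v H₁ ∧ v H₂)
  or : ∀ H₁ H₂, v (.or H₁ H₂) ↔ (v H₁ ∨ v H₂)
  imp : ∀ H₁ H₂, v (.imp H₁ H₂) ↔ (v H₁ → v H₂)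
  iff : ∀ H₁ H₂, v (.iff H₁ H₂) ↔ (v H₁ ↔ v H₂)

/-- The propositional axioms: all formulas that are instances of propositional tautologies. -/
def axa : Set Formula := {H | H ∈ L2 ∧ ∀ v, IsPropValuation v → v H}

/-- The identity axioms, for both kinds of variables: reflexivity and the Leibniz schema
`x_i = x_j → (H(x_i) → H(x_j))`, where `x_j` does not occur bound in `H` (no capture). -/
inductive IdentityAxiom : Formula → Prop
  | reflInd (i : ℕ) : IdentityAxiom (.eqInd i i)
  | reflPred (n : ℕ+) (i : ℕ) : IdentityAxiom (.eqPred n i i)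
  | leibnizInd (i j : ℕ) (H : Formula) (hH : H ∈ L2) (hj : ¬ Formula.BoundInd j H) :
      IdentityAxiom (.imp (.eqInd i j) (.imp H (H.substInd i j)))
  | leibnizPred (n : ℕ+) (i j : ℕ) (H : Formula) (hH : H ∈ L2)
      (hj : ¬ Formula.BoundPred n j H) :
      IdentityAxiom (.imp (.eqPred n i j) (.imp H (H.substPred n i j)))

/-- The set of all identity axioms. -/
def axi : Set Formula := {H | IdentityAxiom H}

/-- The axioms of extensionality `∀ x (A x ↔ B x) → A = B`. -/
def ext : Set Formula :=
  {F | ∃ (n : ℕ+) (i j : ℕ) (x : Fin n → ℕ), Function.Injective x ∧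
    F = .imp (Formula.allTuple x (.iff (.app n i x) (.app n j x))) (.eqPred n i j)}

/-- The axioms of comprehension `∃ A ∀ x (A x ↔ H(x))`, where the variables `x_1, ..., x_n` occur
only free in `H` and `A` does not occur in `H`. Further free variables (parameters) are allowed. -/
def komp : Set Formula :=
  {F | ∃ (n : ℕ+) (i : ℕ) (x : Fin n → ℕ) (H : Formula), Function.Injective x ∧ H ∈ L2 ∧
    (∀ k, ¬ Formula.BoundInd (x k) H) ∧ ¬ Formula.OccursPred n i H ∧
    F = .exPred n i (Formula.allTuple x (.iff (.app n i x) H))}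

/-- The axioms of second-order predicate logic PL II. -/
def ax2 : Set Formula := axa ∪ axi ∪ ext

/-- The axiomatic system of HPL. -/
def hax2 : Set Formula := ax2 ∪ komp

/-- A Henkin–Asser structure is a predicate structure that satisfies comprehension. -/
def IsHenkinAsser (M : PredicateStructure.{u}) : Prop := Models M komp

/-! ### The choice schema and the well-ordering principle -/

/-- The formula `∀ x ∃ D H → ∃ S ∀ x ∃ D (∀ y (D y ↔ S x y) ∧ H)`, where `D` is the `m`-ary
variable of index `d` and `S` the `(n+m)`-ary variable of index `s`. -/
def choiceFormula (n m : ℕ+) (x : Fin n → ℕ) (y : Fin m → ℕ) (d s : ℕ) (H : Formula) : Formula :=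
  .imp (Formula.allTuple x (.exPred m d H))
    (.exPred (n + m) s (Formula.allTuple x (.exPred m d
      (.and (Formula.allTuple y (.iff (.app m d y) (.app (n + m) s (Fin.append x y)))) H))))

/-- The Ackermann axioms `choice_h^{n,m}`: all formulas as above, where `x, y` are lists of pairwise
distinct variables, `x` and `D` occur only free in `H` (which may contain further free variables),
and `S` does not occur in `H`. -/
def choiceH (n m : ℕ+) : Set Formula :=
  {F | ∃ (x : Fin n → ℕ) (y : Fin m → ℕ) (d s : ℕ) (H : Formula),
    Function.Injective x ∧ Function.Injective y ∧ (∀ k l, x k ≠ y l) ∧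
    H ∈ L2 ∧ (∀ k, ¬ Formula.BoundInd (x k) H) ∧ ¬ Formula.BoundPred m d H ∧
    ¬ Formula.OccursPred (n + m) s H ∧
    F = choiceFormula n m x y d s H}

/-- `A x_i` for the unary predicate variable `A` of index `a`. -/
def app1 (a i : ℕ) : Formula := .app 1 a (fun _ => i)

/-- `T x_i x_j` for the binary predicate variable `T` of index `t`. -/
def app2 (t i j : ℕ) : Formula := .app 2 t (![i, j] : Fin 2 → ℕ)

/-- `lo(T, A)`: `T` is a (reflexive) linear ordering of `A`. -/
def lo (t a : ℕ) : Formula :=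
  .and (.allInd 0 (.imp (app1 a 0) (app2 t 0 0)))
  (.and (.allInd 0 (.allInd 1 (.imp (.and (app1 a 0) (app1 a 1))
    (.imp (.and (app2 t 0 1) (app2 t 1 0)) (.eqInd 0 1)))))
  (.and (.allInd 0 (.allInd 1 (.allInd 2 (.imp (.and (app1 a 0) (.and (app1 a 1) (app1 a 2)))
    (.imp (.and (app2 t 0 1) (app2 t 1 2)) (app2 t 0 2))))))
  (.allInd 0 (.allInd 1 (.imp (.and (app1 a 0) (app1 a 1)) (.or (app2 t 0 1) (app2 t 1 0)))))))

/-- `wo(T, A)`: `T` is a linear ordering of `A`, and each non-empty unary predicate `B ⊆ A` has a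
`T`-least element (`b` is the index used for the bound variable `B`). -/
def wo (t a b : ℕ) : Formula :=
  .and (lo t a)
    (.allPred 1 b (.imp (.and (.exInd 0 (app1 b 0)) (.allInd 0 (.imp (app1 b 0) (app1 a 0))))
      (.exInd 0 (.and (app1 b 0) (.allInd 1 (.imp (app1 b 1) (app2 t 0 1)))))))

/-- `WO^1`: every unary predicate can be well-ordered, `∀ A ∃ T wo(T, A)`. -/
def WO1 : Formula := .allPred 1 0 (.exPred 2 0 (wo 0 0 1))

/-! ### Permutation models and the basic Fraenkel model -/

/-- `α^π(ξ) = α(π⁻¹(ξ))`. -/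
def permPred {I : Type u} {n : ℕ} (π : Equiv.Perm I) (α : Pred I n) : Pred I n :=
  fun ξ => α (fun k => π⁻¹ (ξ k))

/-- The symmetry subgroup `{π ∈ G | α^π = α}`. -/
def sym {I : Type u} {n : ℕ} (G : Subgroup (Equiv.Perm I)) (α : Pred I n) :
    Subgroup (Equiv.Perm I) where
  carrier := {π | π ∈ G ∧ permPred π α = α}
  one_mem' := ⟨G.one_mem, rfl⟩
  mul_mem' := by
    rintro π ρ ⟨hπ, h₁⟩ ⟨hρ, h₂⟩
    refine ⟨G.mul_mem hπ hρ, ?_⟩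
    have : permPred (π * ρ) α = permPred π (permPred ρ α) := by
      funext ξ; simp [permPred]
    rw [this, h₂, h₁]
  inv_mem' := by
    rintro π ⟨hπ, h₁⟩
    refine ⟨G.inv_mem hπ, ?_⟩
    conv_lhs => rw [← h₁]
    funext ξ; simp [permPred]

/-- `G(P)`: the elements of `G` that fix each point of `P`. -/
def fix {I : Type u} (G : Subgroup (Equiv.Perm I)) (P : Set I) : Subgroup (Equiv.Perm I) :=
  G ⊓ fixingSubgroup (Equiv.Perm I) P

/-- The normal filter of all subgroups of `G` that contain `G(P)` for some finite `P`. -/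
def finiteSupportFilter (I : Type u) (G : Subgroup (Equiv.Perm I)) :
    Set (Subgroup (Equiv.Perm I)) :=
  {K | K ≤ G ∧ ∃ P : Set I, P.Finite ∧ fix G P ≤ K}

/-- The permutation model over `I` given by `G` and finite supports: its `n`-ary predicates are the
predicates on `I` that are symmetric with respect to the filter above. -/
def permutationModel (I : Type u) [Nonempty I] (G : Subgroup (Equiv.Perm I)) :
    PredicateStructure.{u} where
  J₀ := I
  nonempty_ind := inferInstance
  J := fun n => {α : Pred I n | sym G α ∈ finiteSupportFilter I G}
  nonempty_pred := fun _ =>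
    ⟨fun _ => True, fun _ h => h.1, ∅, Set.finite_empty, fun _ h => ⟨h.1, rfl⟩⟩

/-- The basic Fraenkel model of second order `Σ₀` over `I`, for the group of all permutations. -/
def fraenkelModel (I : Type u) [Nonempty I] : PredicateStructure.{u} :=
  permutationModel I ⊤

end HPL

universe v

namespace HPL

/-! ### Permutations with prescribed values on finite sets -/

section Perm

variable {I : Type v}

/-! Every permutation of `I` acts on the predicates of `Σ₀` and is an automorphism of the structure,
so truth is preserved when all values of an assignment are moved by it (`holds_perm`). A formula
involves finitely many variables, so their values have a common finite support `P`, and whatever the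
formula defines is invariant under the permutations fixing `P`. This gives comprehension.

For choice, let `Φ ξ α` be such an invariant relation. Tuples with the same equality type over `P`
are conjugate by a permutation fixing `P`, and there are finitely many types, so witnesses can be
taken with supports of bounded size. Since `I` is infinite, `P` can be enlarged to a finite `Q` with
enough room to move each such support into `Q` together with the entries of `ξ`, without moving `P`
or `ξ` (`exists_common_support`). A witness chosen for a representative of each type over `Q` is
then carried to the other tuples by permutations fixing `Q`. The result does not depend on the
permutation, because the support of the witness is already prescribed; so the collected relation is
supported by `Q` and lies in the model (`exists_uniform_choice`).

Well-ordering fails because a relation with support `P` cannot distinguish two points outside `P`: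
swapping them contradicts antisymmetry (`not_holds_WO1`). -/

theorem exists_perm_apply_eq {κ : Type*} [Finite κ] (a b : κ → I)
    (h : ∀ k l, a k = a l ↔ b k = b l) : ∃ π : Equiv.Perm I, ∀ k, π (a k) = b k := by
  classical
  obtain ⟨N, ⟨e⟩⟩ := Finite.exists_equiv_fin (Set.range a)
  have hb : ∀ k l, a (Set.rangeSplitting a (e.symm k)) = a (Set.rangeSplitting a (e.symm l)) →
      k = l := by
    intro k l hkl
    simp only [Set.apply_rangeSplitting] at hkl
    exact e.symm.injective (Subtype.ext hkl)
  let x : Fin N ↪ I := ⟨fun k => a (Set.rangeSplitting a (e.symm k)), fun k l => hb k l⟩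
  let y : Fin N ↪ I :=
    ⟨fun k => b (Set.rangeSplitting a (e.symm k)), fun k l hkl => hb k l ((h _ _).2 hkl)⟩
  obtain ⟨π, hπ⟩ := (Equiv.Perm.isMultiplyPretransitive I N).exists_smul_eq x y
  refine ⟨π, fun k => ?_⟩
  have h1 : ∀ l, π (a (Set.rangeSplitting a (e.symm l))) = b (Set.rangeSplitting a (e.symm l)) :=
    fun l => DFunLike.congr_fun hπ l
  have h2 : a (Set.rangeSplitting a ⟨a k, k, rfl⟩) = a k := Set.apply_rangeSplitting a _
  have h3 := h1 (e ⟨a k, k, rfl⟩)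
  rw [Equiv.symm_apply_apply, h2] at h3
  exact h3.trans ((h _ _).1 h2)

/-- The points of `R` outside `E` inject into `Q \ E`, and this finite injection, joined with the
identity on `E`, extends to a permutation. Points of `R ∩ E` stay put, which is why the target is `Q
∪ E`. -/
theorem exists_perm_fixing_mapsTo [DecidableEq I] (E R Q : Finset I)
    (h : (R \ E).card ≤ (Q \ E).card) :
    ∃ π : Equiv.Perm I, (∀ p ∈ E, π p = p) ∧ ∀ p ∈ R, π p ∈ Q ∪ E := by
  obtain ⟨e⟩ : Nonempty (↥(R \ E) ↪ ↥(Q \ E)) :=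
    Function.Embedding.nonempty_of_card_le (by simpa using h)
  have ha : Function.Injective
      (Sum.elim (Subtype.val : ↥E → I) (Subtype.val : ↥(R \ E) → I)) := by
    refine Subtype.val_injective.sumElim Subtype.val_injective ?_
    rintro ⟨p, hp⟩ ⟨q, hq⟩ rfl
    exact (Finset.mem_sdiff.1 hq).2 hp
  have hb : Function.Injective
      (Sum.elim (Subtype.val : ↥E → I) (fun q : ↥(R \ E) => (e q : I))) := by
    refine Subtype.val_injective.sumElim (Subtype.val_injective.comp e.injective) ?_
    rintro ⟨p, hp⟩ q hq
    exact (Finset.mem_sdiff.1 (e q).2).2 (by rw [← hq]; exact hp)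
  obtain ⟨π, hπ⟩ := exists_perm_apply_eq
    (Sum.elim (Subtype.val : ↥E → I) (Subtype.val : ↥(R \ E) → I))
    (Sum.elim (Subtype.val : ↥E → I) (fun q : ↥(R \ E) => (e q : I)))
    fun k l => ha.eq_iff.trans hb.eq_iff.symm
  have hE : ∀ p ∈ E, π p = p := fun p hp => hπ (Sum.inl ⟨p, hp⟩)
  refine ⟨π, hE, fun p hp => ?_⟩
  by_cases hpE : p ∈ E
  · rw [hE p hpE]; exact Finset.mem_union_right _ hpE
  · have h1 : π p = e ⟨p, Finset.mem_sdiff.2 ⟨hp, hpE⟩⟩ :=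
      hπ (Sum.inr ⟨p, Finset.mem_sdiff.2 ⟨hp, hpE⟩⟩)
    rw [h1]
    exact Finset.mem_union_left _ (Finset.mem_sdiff.1 (e _).2).1

/-- The equality type of a tuple over a set of parameters. -/
def eqType {n : ℕ} (P : Finset I) (ξ : Fin n → I) :
    (Fin n → Fin n → Prop) × (Fin n → ↥P → Prop) :=
  (fun i j => ξ i = ξ j, fun i p => ξ i = p)

/-- With `eqType_perm`, this makes the equality type a complete invariant of the orbits of tuples
under the pointwise stabilizer of `P`. Its values lie in a finite type, so there are finitely many
orbits. -/
theorem exists_perm_of_eqType_eq {n : ℕ} {P : Finset I} {ξ ξ' : Fin n → I}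
    (h : eqType P ξ = eqType P ξ') :
    ∃ π : Equiv.Perm I, (∀ p ∈ P, π p = p) ∧ ∀ i, π (ξ i) = ξ' i := by
  have h1 : ∀ i j, ξ i = ξ j ↔ ξ' i = ξ' j := fun i j =>
    iff_of_eq (congrFun (congrFun (congrArg Prod.fst h) i) j)
  have h2 : ∀ i (p : ↥P), ξ i = p ↔ ξ' i = p := fun i p =>
    iff_of_eq (congrFun (congrFun (congrArg Prod.snd h) i) p)
  obtain ⟨π, hπ⟩ := exists_perm_apply_eq (Sum.elim (Subtype.val : ↥P → I) ξ)
    (Sum.elim (Subtype.val : ↥P → I) ξ') (by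
      rintro (p | i) (q | j)
      · rfl
      · simpa [eq_comm] using h2 j p
      · exact h2 i q
      · exact h1 i j)
  exact ⟨π, fun p hp => hπ (Sum.inl ⟨p, hp⟩), fun i => hπ (Sum.inr i)⟩

theorem eqType_perm {n : ℕ} {P : Finset I} (ξ : Fin n → I) {π : Equiv.Perm I}
    (hπ : ∀ p ∈ P, π p = p) : eqType P (fun i => π (ξ i)) = eqType P ξ := by
  refine Prod.ext ?_ ?_
  · funext i j
    exact propext π.injective.eq_iff
  · funext i p
    refine propext ⟨fun h => π.injective (h.trans (hπ p p.2).symm), fun h => ?_⟩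
    exact (congrArg π h).trans (hπ p p.2)

/-! ### Supports of predicates -/

/-- `α` is invariant under all permutations that fix each point of `P`. -/
def SupportedBy {n : ℕ} (P : Finset I) (α : Pred I n) : Prop :=
  ∀ π : Equiv.Perm I, (∀ p ∈ P, π p = p) → permPred π α = α

theorem SupportedBy.mono {n : ℕ} {P Q : Finset I} {α : Pred I n} (h : SupportedBy P α)
    (hPQ : P ⊆ Q) : SupportedBy Q α :=
  fun π hπ => h π fun p hp => hπ p (hPQ hp)

theorem permPred_mul {n : ℕ} (π ρ : Equiv.Perm I) (α : Pred I n) :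
    permPred (π * ρ) α = permPred π (permPred ρ α) := by
  funext ξ; simp [permPred]

theorem permPred_one {n : ℕ} (α : Pred I n) : permPred 1 α = α := by
  funext ξ; simp [permPred]

theorem permPred_apply_perm {n : ℕ} (π : Equiv.Perm I) (α : Pred I n) (ξ : Fin n → I) :
    permPred π α (fun k => π (ξ k)) ↔ α ξ := by
  simp [permPred]

theorem permPred_inv_permPred {n : ℕ} (π : Equiv.Perm I) (α : Pred I n) :
    permPred π⁻¹ (permPred π α) = α := by
  rw [← permPred_mul, inv_mul_cancel, permPred_one]

theorem permPred_permPred_inv {n : ℕ} (π : Equiv.Perm I) (α : Pred I n) :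
    permPred π (permPred π⁻¹ α) = α := by
  rw [← permPred_mul, mul_inv_cancel, permPred_one]

/-- Conjugating by `π` turns a permutation fixing `π(P)` pointwise into one fixing `P` pointwise. -/
theorem SupportedBy.permPred [DecidableEq I] {n : ℕ} {P : Finset I} {α : Pred I n}
    (h : SupportedBy P α) (π : Equiv.Perm I) :
    SupportedBy (P.image π) (permPred π α) := by
  intro ρ hρ
  have h1 := h (π⁻¹ * ρ * π) fun p hp => by
    simp [hρ (π p) (Finset.mem_image_of_mem _ hp)]
  calc HPL.permPred ρ (HPL.permPred π α)
      = HPL.permPred π (HPL.permPred (π⁻¹ * ρ * π) α) := by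
        simp only [← permPred_mul]; congr 1; group
    _ = HPL.permPred π α := by rw [h1]

theorem supportedBy_notMem {n : ℕ} (P : Finset I) (k : Fin n) :
    SupportedBy P fun ξ : Fin n → I => ξ k ∉ P := by
  intro π hπ
  funext ξ
  refine propext (not_congr ⟨fun (hp : π⁻¹ (ξ k) ∈ P) => ?_, fun hp => ?_⟩)
  · have h : ξ k = π⁻¹ (ξ k) :=
      (Equiv.Perm.inv_eq_iff_eq.1 (Eq.refl (π⁻¹ (ξ k)))).trans (hπ _ hp)
    rw [h]; exact hp
  · show π⁻¹ (ξ k) ∈ P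
    rw [Equiv.Perm.inv_eq_iff_eq.2 (hπ _ hp).symm]; exact hp

variable [Nonempty I]

theorem mem_fraenkelModel_iff {n : ℕ+} {α : Pred I n} :
    α ∈ (fraenkelModel I).J n ↔ ∃ P : Finset I, SupportedBy P α := by
  constructor
  · rintro ⟨-, P, hP, h⟩
    refine ⟨hP.toFinset, fun π hπ => (h ⟨trivial, ?_⟩).2⟩
    exact (mem_fixingSubgroup_iff _).2 fun p hp => hπ p (by simpa using hp)
  · rintro ⟨P, h⟩
    refine ⟨fun _ _ => trivial, P, P.finite_toSet, fun π hπ => ⟨trivial, h π fun p hp => ?_⟩⟩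
    exact (mem_fixingSubgroup_iff _).1 hπ.2 p hp

/-- The action of a permutation on the `n`-ary predicates of the Fraenkel model. -/
def permJ (π : Equiv.Perm I) (n : ℕ+) : (fraenkelModel I).J n ≃ (fraenkelModel I).J n where
  toFun α := ⟨permPred π α.1, by
    classical
    obtain ⟨P, h⟩ := mem_fraenkelModel_iff.1 α.2
    exact mem_fraenkelModel_iff.2 ⟨_, h.permPred π⟩⟩
  invFun α := ⟨permPred π⁻¹ α.1, by
    classical
    obtain ⟨P, h⟩ := mem_fraenkelModel_iff.1 α.2
    exact mem_fraenkelModel_iff.2 ⟨_, h.permPred π⁻¹⟩⟩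
  left_inv α := Subtype.ext (permPred_inv_permPred π α.1)
  right_inv α := Subtype.ext (permPred_permPred_inv π α.1)

theorem permJ_val (π : Equiv.Perm I) (n : ℕ+) (α : (fraenkelModel I).J n) :
    (permJ π n α).1 = permPred π α.1 := rfl

theorem permJ_one (n : ℕ+) (α : (fraenkelModel I).J n) : permJ 1 n α = α :=
  Subtype.ext (permPred_one _)

end Perm

/-! ### Uniform choice for relations with finite support -/

section Choice

variable {I : Type v} [Infinite I]

/-- A witness for one representative of each equality type is transported to all tuples of that
type; transport does not increase the size of a support, and there are finitely many types. -/
theorem exists_card_bound {n : ℕ} {m : ℕ+} {P : Finset I}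
    {Φ : (Fin n → I) → (fraenkelModel I).J m → Prop}
    (hΦ : ∀ π : Equiv.Perm I, (∀ p ∈ P, π p = p) → ∀ ξ α, Φ ξ α →
      Φ (fun i => π (ξ i)) (permJ π m α))
    (hex : ∀ ξ, ∃ α, Φ ξ α) :
    ∃ r : ℕ, ∀ ξ, ∃ α, Φ ξ α ∧ ∃ R : Finset I, R.card ≤ r ∧ SupportedBy R α.1 := by
  classical
  choose D hD using hex
  choose R hR using fun ξ => mem_fraenkelModel_iff.1 (D ξ).2
  -- For a type realized by no tuple, `invFun` returns an arbitrary tuple; this only adds an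
  -- irrelevant value to a finite range.
  obtain ⟨r, hr⟩ := (Set.finite_range
    fun t => (R (Function.invFun (eqType (n := n) P) t)).card).bddAbove
  refine ⟨r, fun ξ => ?_⟩
  obtain ⟨π, hπ, hξ⟩ := exists_perm_of_eqType_eq
    (Function.invFun_eq (f := eqType (n := n) P) ⟨ξ, rfl⟩)
  refine ⟨permJ π m (D (Function.invFun (eqType P) (eqType P ξ))), ?_, _, ?_, (hR _).permPred π⟩
  · have := hΦ π hπ _ _ (hD (Function.invFun (eqType P) (eqType P ξ)))
    simpa only [hξ] using this
  · exact Finset.card_image_le.trans (hr ⟨eqType P ξ, rfl⟩)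

/-- A witness for `ξ` may be replaced by its image under any permutation fixing `P` and the entries
of `ξ`. Such a permutation moves its small support into `Q` and the entries of `ξ`. -/
theorem exists_common_support {n : ℕ} {m : ℕ+} {P : Finset I} [DecidableEq I]
    {Φ : (Fin n → I) → (fraenkelModel I).J m → Prop}
    (hΦ : ∀ π : Equiv.Perm I, (∀ p ∈ P, π p = p) → ∀ ξ α, Φ ξ α →
      Φ (fun i => π (ξ i)) (permJ π m α))
    (hex : ∀ ξ, ∃ α, Φ ξ α) :
    ∃ Q : Finset I, P ⊆ Q ∧
      ∀ ξ, ∃ α, Φ ξ α ∧ SupportedBy (Q ∪ Finset.univ.image ξ) α.1 := by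
  obtain ⟨r, hr⟩ := exists_card_bound hΦ hex
  -- At most `P.card + n` points of `Q` are taken up by `P` and `ξ`, so at least `r` remain free to
  -- receive the support.
  obtain ⟨Q, hPQ, hQ⟩ := Infinite.exists_superset_card_eq P (P.card + n + r) (by omega)
  refine ⟨Q, hPQ, fun ξ => ?_⟩
  obtain ⟨α, hα, R, hRr, hR⟩ := hr ξ
  set E : Finset I := P ∪ Finset.univ.image ξ with hE
  have hEcard : E.card ≤ P.card + n :=
    (Finset.card_union_le _ _).trans
      (Nat.add_le_add_left (Finset.card_image_le.trans (by simp)) _)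
  obtain ⟨π, hπE, hπR⟩ := exists_perm_fixing_mapsTo E R Q (by
    have h1 : (R \ E).card ≤ R.card := Finset.card_le_card Finset.sdiff_subset
    have h2 := Finset.le_card_sdiff E Q
    omega)
  have hξ : ∀ i, π (ξ i) = ξ i := fun i =>
    hπE _ (Finset.mem_union_right _ (Finset.mem_image_of_mem _ (Finset.mem_univ i)))
  refine ⟨permJ π m α, ?_, (hR.permPred π).mono ?_⟩
  · have := hΦ π (fun p hp => hπE p (Finset.mem_union_left _ hp)) ξ α hα
    simpa only [hξ] using this
  · intro q hq
    obtain ⟨p, hp, rfl⟩ := Finset.mem_image.1 hq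
    have := hπR p hp
    rw [hE] at this
    simp only [Finset.mem_union] at this ⊢
    rcases this with h | h | h
    · exact Or.inl h
    · exact Or.inl (hPQ h)
    · exact Or.inr h

theorem exists_uniform_choice {n m : ℕ+} {P : Finset I}
    {Φ : (Fin n → I) → (fraenkelModel I).J m → Prop}
    (hΦ : ∀ π : Equiv.Perm I, (∀ p ∈ P, π p = p) → ∀ ξ α, Φ ξ α →
      Φ (fun i => π (ξ i)) (permJ π m α))
    (hex : ∀ ξ, ∃ α, Φ ξ α) :
    ∃ σ : (fraenkelModel I).J (n + m), ∀ ξ, ∃ α,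
      (∀ η : Fin m → I, α.1 η ↔ σ.1 (Fin.append ξ η)) ∧ Φ ξ α := by
  classical
  obtain ⟨Q, hPQ, hQ⟩ := exists_common_support hΦ hex
  choose D hD hDsupp using hQ
  -- The representative depends only on the type of `ξ` over `Q`, so it is unchanged by permutations
  -- fixing `Q`.
  let rep : (Fin n → I) → (Fin n → I) := fun ξ => Function.invFun (eqType Q) (eqType Q ξ)
  have hrep : ∀ ξ, eqType Q (rep ξ) = eqType Q ξ := fun ξ => Function.invFun_eq ⟨ξ, rfl⟩
  -- Quantifying over all transporting permutations, instead of choosing one, makes invariance under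
  -- the stabilizer of `Q` immediate.
  let rel : (Fin n → I) → (Fin m → I) → Prop := fun ξ η =>
    ∃ π : Equiv.Perm I, (∀ p ∈ Q, π p = p) ∧ (∀ i, π (rep ξ i) = ξ i) ∧
      permPred π (D (rep ξ)).1 η
  have hinv : ∀ ρ : Equiv.Perm I, (∀ p ∈ Q, ρ p = p) → ∀ ξ η, rel ξ η →
      rel (fun i => ρ (ξ i)) (fun i => ρ (η i)) := by
    rintro ρ hρ ξ η ⟨π, hπ, hξ, hη⟩
    have hr : rep (fun i => ρ (ξ i)) = rep ξ := by
      simp only [rep, eqType_perm ξ hρ]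
    refine ⟨ρ * π, fun p hp => by simp [hπ p hp, hρ p hp], fun i => ?_, ?_⟩
    · simp [hr, hξ]
    · rw [hr]
      have h := (permPred_apply_perm ρ (permPred π (D (rep ξ)).1) η).2 hη
      exact cast (congrFun (permPred_mul ρ π _).symm _) h
  let S : Pred I ((n : ℕ) + m) := fun ζ =>
    rel (fun i => ζ (Fin.castAdd m i)) (fun j => ζ (Fin.natAdd n j))
  have hS : SupportedBy Q S := by
    intro ρ hρ
    have hρ' : ∀ p ∈ Q, ρ⁻¹ p = p := fun p hp => by
      rw [Equiv.Perm.inv_eq_iff_eq, hρ p hp]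
    funext ζ
    refine propext ⟨fun h => ?_, fun h => hinv _ hρ' _ _ h⟩
    simpa [permPred] using hinv ρ hρ _ _ h
  refine ⟨⟨S, mem_fraenkelModel_iff.2 ⟨Q, hS⟩⟩, fun ξ => ?_⟩
  obtain ⟨π, hπ, hξ⟩ := exists_perm_of_eqType_eq (hrep ξ)
  refine ⟨permJ π m (D (rep ξ)), fun η => ?_, ?_⟩
  · have h1 : S (Fin.append ξ η) ↔ rel ξ η :=
      iff_of_eq (congrArg₂ rel (funext fun i => Fin.append_left ξ η i)
        (funext fun j => Fin.append_right ξ η j))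
    refine Iff.trans ?_ h1.symm
    refine ⟨fun h => ⟨π, hπ, hξ, h⟩, ?_⟩
    rintro ⟨ρ, hρ, hρξ, h⟩
    -- Independence of the transporting permutation: `π` and `ρ` agree on `Q` and on `rep ξ`, hence
    -- on a support of the chosen witness.
    have h2 : permPred (π⁻¹ * ρ) (D (rep ξ)).1 = (D (rep ξ)).1 := by
      refine hDsupp (rep ξ) _ fun p hp => ?_
      rw [Equiv.Perm.mul_apply, Equiv.Perm.inv_eq_iff_eq]
      rcases Finset.mem_union.1 hp with hp | hp
      · rw [hπ p hp, hρ p hp]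
      · obtain ⟨i, -, rfl⟩ := Finset.mem_image.1 hp
        rw [hξ, hρξ]
    have h3 : permPred ρ (D (rep ξ)).1 = permPred π (D (rep ξ)).1 := by
      refine Eq.trans ?_ (congrArg (permPred π) h2)
      exact (congrArg (permPred · _) (mul_inv_cancel_left π ρ).symm).trans (permPred_mul _ _ _)
    rw [h3] at h
    exact h
  · have := hΦ π (fun p hp => hπ p (hPQ hp)) _ _ (hD (rep ξ))
    simpa only [hξ] using this

end Choice

/-! ### Semantics of arbitrary predicate structures -/

namespace Assignment

variable {M : PredicateStructure.{v}}

@[ext]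
theorem ext {f g : Assignment M} (h₁ : f.ind = g.ind) (h₂ : f.pred = g.pred) : f = g := by
  cases f; cases g; simp_all

/-- The assignment that maps the variables `x k` to `ξ k` and otherwise agrees with `f`. -/
noncomputable def setTuple {n : ℕ} (f : Assignment M) (x : Fin n → ℕ) (ξ : Fin n → M.J₀) :
    Assignment M :=
  { f with ind := Function.extend x ξ f.ind }

end Assignment

section Semantics

variable {M : PredicateStructure.{v}}

/-- As the variables are distinct, the successive updates never overwrite one another and amount to
a single simultaneous one. -/
theorem holds_allTuple {n : ℕ} {x : Fin n → ℕ} (hx : Function.Injective x) (H : Formula)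
    (f : Assignment M) :
    Holds M (Formula.allTuple x H) f ↔ ∀ ξ : Fin n → M.J₀, Holds M H (f.setTuple x ξ) := by
  induction n generalizing f with
  | zero =>
    have h : ∀ ξ : Fin 0 → M.J₀, f.setTuple x ξ = f := fun ξ => by
      refine Assignment.ext (funext fun k => ?_) rfl
      exact Function.extend_apply' _ _ _ fun ⟨i, _⟩ => i.elim0
    simp [Formula.allTuple, h]
  | succ n ih =>
    have hx' : Function.Injective (x ∘ Fin.succ) := hx.comp (Fin.succ_injective n)
    have h1 : Formula.allTuple x H = .allInd (x 0) (Formula.allTuple (x ∘ Fin.succ) H) := by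
      simp [Formula.allTuple, List.ofFn_succ, Function.comp_def]
    have h2 : ∀ (a : M.J₀) (ξ : Fin n → M.J₀),
        (f.setInd (x 0) a).setTuple (x ∘ Fin.succ) ξ =
          f.setTuple x (Fin.cons a ξ : Fin (n + 1) → M.J₀) := by
      intro a ξ
      refine Assignment.ext (funext fun k => ?_) rfl
      show Function.extend (x ∘ Fin.succ) ξ (Function.update f.ind (x 0) a) k =
        Function.extend x (Fin.cons a ξ : Fin (n + 1) → M.J₀) f.ind k
      by_cases hk : ∃ i, x i = k
      · obtain ⟨i, rfl⟩ := hk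
        rw [hx.extend_apply]
        refine Fin.cases ?_ (fun j => ?_) i
        · rw [Function.extend_apply']
          · simp
          · rintro ⟨j, hj⟩
            exact Fin.succ_ne_zero j (hx hj)
        · exact hx'.extend_apply ξ _ j
      · rw [Function.extend_apply' _ _ _ hk, Function.extend_apply', Function.update_of_ne]
        · rintro rfl; exact hk ⟨0, rfl⟩
        · rintro ⟨j, hj⟩; exact hk ⟨j.succ, hj⟩
    rw [h1]
    show (∀ a, Holds M (Formula.allTuple (x ∘ Fin.succ) H) (f.setInd (x 0) a)) ↔ _
    simp only [ih hx', h2]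
    exact ⟨fun h ξ => by simpa using h (ξ 0) (Fin.tail ξ), fun h a ξ => h _⟩

/-- Since `x_j` is never bound, no quantifier changes its value, so `x_i` and `x_j` keep equal
values until `x_i` itself is bound; there the substitution stops. -/
theorem holds_substInd {i j : ℕ} {H : Formula} (hj : ¬ H.BoundInd j) {f : Assignment M}
    (hf : f.ind i = f.ind j) : Holds M (H.substInd i j) f ↔ Holds M H f := by
  have hif : ∀ (g : Assignment M), g.ind i = g.ind j → ∀ k,
      g.ind (if k = i then j else k) = g.ind k := by
    intro g hg k; split_ifs with h
    · rw [h, hg]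
    · rfl
  induction H generalizing f with
  | app n k x => simp [Formula.substInd, Holds, hif f hf]
  | eqInd k l => simp [Formula.substInd, Holds, hif f hf]
  | eqPred n k l => simp [Formula.substInd, Holds]
  | neg H ih => simp [Formula.substInd, Holds, ih hj hf]
  | and H₁ H₂ ih₁ ih₂ | or H₁ H₂ ih₁ ih₂ | imp H₁ H₂ ih₁ ih₂ | iff H₁ H₂ ih₁ ih₂ =>
    simp only [Formula.BoundInd, not_or] at hj
    simp [Formula.substInd, Holds, ih₁ hj.1 hf, ih₂ hj.2 hf]
  | allInd k H ih | exInd k H ih =>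
    simp only [Formula.BoundInd, not_or] at hj
    by_cases hk : k = i
    · simp [Formula.substInd, hk]
    · have h : ∀ a, (f.setInd k a).ind i = (f.setInd k a).ind j := fun a => by
        simp [Assignment.setInd, Function.update_of_ne hj.1, Function.update_of_ne (Ne.symm hk), hf]
      simp [Formula.substInd, hk, Holds, ih hj.2 (h _)]
  | allPred n k H ih | exPred n k H ih =>
    have h : ∀ a, (f.setPred n k a).ind i = (f.setPred n k a).ind j := fun _ => hf
    simp [Formula.substInd, Holds, ih hj (h _)]

theorem holds_substPred {m : ℕ+} {i j : ℕ} {H : Formula} (hj : ¬ H.BoundPred m j)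
    {f : Assignment M} (hf : f.pred (m, i) = f.pred (m, j)) :
    Holds M (H.substPred m i j) f ↔ Holds M H f := by
  have hif : ∀ (g : Assignment M), g.pred (m, i) = g.pred (m, j) → ∀ (n : ℕ+) (k : ℕ),
      g.pred (n, if n = m ∧ k = i then j else k) = g.pred (n, k) := by
    intro g hg n k
    by_cases h : n = m ∧ k = i
    · rw [if_pos h]
      obtain ⟨rfl, rfl⟩ := h
      exact hg.symm
    · rw [if_neg h]
  induction H generalizing f with
  | app n k x => simp only [Formula.substPred, Holds, hif f hf]
  | eqInd k l => simp [Formula.substPred, Holds]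
  | eqPred n k l => simp only [Formula.substPred, Holds, hif f hf]
  | neg H ih => simp [Formula.substPred, Holds, ih hj hf]
  | and H₁ H₂ ih₁ ih₂ | or H₁ H₂ ih₁ ih₂ | imp H₁ H₂ ih₁ ih₂ | iff H₁ H₂ ih₁ ih₂ =>
    simp only [Formula.BoundPred, not_or] at hj
    simp [Formula.substPred, Holds, ih₁ hj.1 hf, ih₂ hj.2 hf]
  | allInd k H ih | exInd k H ih =>
    have h : ∀ a, (f.setInd k a).pred (m, i) = (f.setInd k a).pred (m, j) := fun _ => hf
    simp [Formula.substPred, Holds, ih hj (h _)]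
  | allPred n k H ih | exPred n k H ih =>
    simp only [Formula.BoundPred, not_or] at hj
    by_cases hk : n = m ∧ k = i
    · simp [Formula.substPred, hk]
    · have h : ∀ a, (f.setPred n k a).pred (m, i) = (f.setPred n k a).pred (m, j) := fun a => by
        have h1 : (m, i) ≠ (n, k) := fun h =>
          hk ⟨(Prod.ext_iff.1 h).1.symm, (Prod.ext_iff.1 h).2.symm⟩
        have h2 : (m, j) ≠ (n, k) := fun h => hj.1 (Prod.ext_iff.1 h)
        simp only [Assignment.setPred, Function.update_of_ne h1, Function.update_of_ne h2, hf]
      simp [Formula.substPred, hk, Holds, ih hj.2 (h _)]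

theorem models_axa : Models M axa := fun _ hH f =>
  hH.2 (fun H => Holds M H f)
    ⟨fun _ => Iff.rfl, fun _ _ => Iff.rfl, fun _ _ => Iff.rfl, fun _ _ => Iff.rfl,
      fun _ _ => Iff.rfl⟩

theorem models_axi : Models M axi := by
  rintro _ (i | ⟨n, i⟩ | ⟨i, j, H, -, hj⟩ | ⟨n, i, j, H, -, hj⟩) f
  · rfl
  · rfl
  · exact fun hf h => (holds_substInd hj hf).2 h
  · exact fun hf h => (holds_substPred hj hf).2 h

theorem models_ext : Models M ext := by
  rintro _ ⟨n, i, j, x, hx, rfl⟩ f h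
  rw [holds_allTuple hx] at h
  refine Subtype.ext (funext fun ξ => propext ?_)
  simpa [Holds, Assignment.setTuple, hx.extend_apply] using h ξ

end Semantics

/-! ### Invariance of truth under permutations -/

/-- The individual variables that occur in a formula. -/
def Formula.indVars : Formula → Finset ℕ
  | app _ _ x => Finset.univ.image x
  | eqInd i j => {i, j}
  | eqPred _ _ _ => ∅
  | neg H => indVars H
  | and H₁ H₂ => indVars H₁ ∪ indVars H₂
  | or H₁ H₂ => indVars H₁ ∪ indVars H₂
  | imp H₁ H₂ => indVars H₁ ∪ indVars H₂
  | iff H₁ H₂ => indVars H₁ ∪ indVars H₂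
  | allInd _ H => indVars H
  | exInd _ H => indVars H
  | allPred _ _ H => indVars H
  | exPred _ _ H => indVars H

theorem Formula.finite_occursPred (H : Formula) :
    {w : ℕ+ × ℕ | H.OccursPred w.1 w.2}.Finite := by
  induction H with
  | app n i x =>
    exact (Set.finite_singleton (n, i)).subset fun w hw => Prod.ext hw.1 hw.2
  | eqInd i j => exact Set.finite_empty
  | eqPred n i j =>
    refine (Set.toFinite {(n, i), (n, j)}).subset fun w hw => ?_
    exact hw.2.imp (Prod.ext hw.1) (Prod.ext hw.1)
  | neg H ih | allInd i H ih | exInd i H ih => exact ih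
  | and H₁ H₂ ih₁ ih₂ | or H₁ H₂ ih₁ ih₂ | imp H₁ H₂ ih₁ ih₂ | iff H₁ H₂ ih₁ ih₂ =>
    exact ih₁.union ih₂
  | allPred n i H ih | exPred n i H ih =>
    refine (ih.insert (n, i)).subset fun w hw => ?_
    exact hw.imp (fun h => Prod.ext h.1 h.2) id

theorem extend_perm {I : Type v} {n : ℕ} {x : Fin n → ℕ} (hx : Function.Injective x) (ξ : Fin n → I)
    {a b : ℕ → I} (π : Equiv.Perm I) {i : ℕ} (h : b i = π (a i)) :
    Function.extend x (fun k => π (ξ k)) b i = π (Function.extend x ξ a i) := by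
  by_cases hi : ∃ k, x k = i
  · obtain ⟨k, rfl⟩ := hi
    simp [hx.extend_apply]
  · simpa [Function.extend_apply' _ _ _ hi] using h

section Fraenkel

variable {I : Type v} [Nonempty I]

/-- In the quantifier cases the range is reindexed by the bijection `π` or `permJ π n`. Only
variables occurring in `H` are constrained: this lets a finite support suffice, and makes `π = 1` a
coincidence lemma. -/
theorem holds_perm (π : Equiv.Perm I) {H : Formula} {f g : Assignment (fraenkelModel I)}
    (hind : ∀ i ∈ H.indVars, g.ind i = π (f.ind i))
    (hpred : ∀ w : ℕ+ × ℕ, H.OccursPred w.1 w.2 → g.pred w = permJ π w.1 (f.pred w)) :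
    Holds (fraenkelModel I) H f ↔ Holds (fraenkelModel I) H g := by
  induction H generalizing f g with
  | app n i x =>
    have h : ∀ k, g.ind (x k) = π (f.ind (x k)) := fun k =>
      hind _ (Finset.mem_image_of_mem x (Finset.mem_univ k))
    simp only [Holds, h, hpred (n, i) ⟨rfl, rfl⟩, permJ_val]
    exact (permPred_apply_perm π _ _).symm
  | eqInd i j =>
    have hi := hind i (by simp [Formula.indVars])
    have hj := hind j (by simp [Formula.indVars])
    simp only [Holds, hi, hj]
    exact π.injective.eq_iff.symm
  | eqPred n i j =>
    simp only [Holds, hpred (n, i) ⟨rfl, Or.inl rfl⟩, hpred (n, j) ⟨rfl, Or.inr rfl⟩]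
    exact (permJ π n).injective.eq_iff.symm
  | neg H ih => exact not_congr (ih hind hpred)
  | and H₁ H₂ ih₁ ih₂ | or H₁ H₂ ih₁ ih₂ | imp H₁ H₂ ih₁ ih₂ | iff H₁ H₂ ih₁ ih₂ =>
    have h₁ := ih₁ (fun i hi => hind i (Finset.mem_union_left _ hi))
      (fun w hw => hpred w (Or.inl hw))
    have h₂ := ih₂ (fun i hi => hind i (Finset.mem_union_right _ hi))
      (fun w hw => hpred w (Or.inr hw))
    simp only [Holds, h₁, h₂]
  | allInd k H ih | exInd k H ih =>
    have h : ∀ a, Holds (fraenkelModel I) H (f.setInd k a) ↔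
        Holds (fraenkelModel I) H (g.setInd k (π a)) := fun a => by
      refine ih (fun i hi => ?_) hpred
      by_cases hik : i = k
      · subst hik
        exact (Function.update_self i (π a) g.ind).trans
          (congrArg π (Function.update_self i a f.ind).symm)
      · exact (Function.update_of_ne hik ..).trans
          ((hind i hi).trans (congrArg π (Function.update_of_ne hik ..).symm))
    first
    | exact Equiv.forall_congr π fun {a} => h a
    | exact Equiv.exists_congr π h
  | allPred n k H ih | exPred n k H ih =>
    have h : ∀ a, Holds (fraenkelModel I) H (f.setPred n k a) ↔
        Holds (fraenkelModel I) H (g.setPred n k (permJ π n a)) := fun a => by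
      refine ih hind fun w hw => ?_
      by_cases hwk : w = (n, k)
      · subst hwk; simp [Assignment.setPred]
      · simpa [Assignment.setPred, Function.update_of_ne hwk] using hpred w (Or.inr hw)
    first
    | exact Equiv.forall_congr (permJ π n) fun {a} => h a
    | exact Equiv.exists_congr (permJ π n) h

theorem holds_setPred_of_not_occursPred {n : ℕ+} {i : ℕ} {H : Formula}
    (hH : ¬ H.OccursPred n i) (f : Assignment (fraenkelModel I)) (α : (fraenkelModel I).J n) :
    Holds (fraenkelModel I) H (f.setPred n i α) ↔ Holds (fraenkelModel I) H f := by
  refine (holds_perm (f := f) (g := f.setPred n i α) (1 : Equiv.Perm I) (fun _ _ => rfl)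
    fun w hw => ?_).symm
  have hwk : w ≠ (n, i) := by rintro rfl; exact hH hw
  rw [permJ_one]
  exact Function.update_of_ne hwk _ _

/-- A finite set that supports all values of the variables occurring in `H`. -/
theorem exists_support (H : Formula) (f : Assignment (fraenkelModel I)) :
    ∃ P : Finset I, ∀ π : Equiv.Perm I, (∀ p ∈ P, π p = p) →
      (∀ i ∈ H.indVars, f.ind i = π (f.ind i)) ∧
      ∀ w : ℕ+ × ℕ, H.OccursPred w.1 w.2 → f.pred w = permJ π w.1 (f.pred w) := by
  classical
  choose R hR using fun w : ℕ+ × ℕ => mem_fraenkelModel_iff.1 (f.pred w).2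
  refine ⟨H.indVars.image f.ind ∪ H.finite_occursPred.toFinset.biUnion R, fun π hπ =>
    ⟨fun i hi => ?_, fun w hw => ?_⟩⟩
  · exact (hπ _ (Finset.mem_union_left _ (Finset.mem_image_of_mem _ hi))).symm
  · refine Subtype.ext (hR w π fun p hp => hπ p ?_).symm
    exact Finset.mem_union_right _ (Finset.mem_biUnion.2 ⟨w, by simpa using hw, hp⟩)

/-- A finite support of the parameters of `H` also supports the predicate that `H` defines. -/
theorem isHenkinAsser_fraenkelModel : IsHenkinAsser (fraenkelModel I) := by
  rintro _ ⟨n, i, x, H, hx, -, -, hA, rfl⟩ f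
  obtain ⟨P, hP⟩ := exists_support H f
  have hinv : ∀ π : Equiv.Perm I, (∀ p ∈ P, π p = p) → ∀ ξ : Fin n → I,
      Holds (fraenkelModel I) H (f.setTuple x ξ) ↔
        Holds (fraenkelModel I) H (f.setTuple x fun k => π (ξ k)) := fun π hπ ξ =>
    holds_perm π (fun i hi => extend_perm hx ξ π ((hP π hπ).1 i hi)) (hP π hπ).2
  let α : (fraenkelModel I).J n := ⟨fun ξ => Holds (fraenkelModel I) H (f.setTuple x ξ),
    mem_fraenkelModel_iff.2 ⟨P, fun π hπ => funext fun ξ => propext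
      ((hinv π hπ _).trans (by simp))⟩⟩
  refine ⟨α, (holds_allTuple hx _ _).2 fun ξ => ?_⟩
  have h1 : (f.setPred n i α).setTuple x ξ = (f.setTuple x ξ).setPred n i α := rfl
  show _ ↔ _
  rw [h1, holds_setPred_of_not_occursPred hA]
  simp [Holds, Assignment.setPred, Assignment.setTuple, hx.extend_apply, α]

end Fraenkel

/-! ### Choice and the failure of well-ordering in `Σ₀` -/

section Infinite

variable {I : Type v} [Infinite I]

theorem models_choiceH (n m : ℕ+) : Models (fraenkelModel I) (choiceH n m) := by
  rintro _ ⟨x, y, d, s, H, hx, hy, hxy, -, -, -, hS, rfl⟩ f hex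
  rw [holds_allTuple hx] at hex
  obtain ⟨P, hP⟩ := exists_support H f
  -- The relation is invariant under permutations fixing `P`: they preserve the parameters, while
  -- the values of `x` and `D` move along with the arguments.
  obtain ⟨σ, hσ⟩ := exists_uniform_choice (P := P)
    (Φ := fun ξ α => Holds (fraenkelModel I) H ((f.setTuple x ξ).setPred m d α))
    (fun π hπ ξ α h => (holds_perm π
      (fun i hi => extend_perm hx ξ π ((hP π hπ).1 i hi)) (fun w hw => by
        by_cases hwd : w = (m, d)
        · subst hwd; simp [Assignment.setPred]
        · simp only [Assignment.setPred, Function.update_of_ne hwd]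
          exact (hP π hπ).2 w hw)).1 h)
    hex
  -- Because `n ≥ 1`, `S` and `D` have different arities and are distinct variables even if `s = d`.
  have hne : ((n + m, s) : ℕ+ × ℕ) ≠ (m, d) := fun h => by
    have := congrArg (fun w : ℕ+ × ℕ => (w.1 : ℕ)) h
    have hn := n.pos
    simp at this
  refine ⟨σ, (holds_allTuple hx _ _).2 fun ξ => ?_⟩
  obtain ⟨α, hα, hH⟩ := hσ ξ
  have hcomm : ((f.setPred (n + m) s σ).setTuple x ξ).setPred m d α =
      ((f.setTuple x ξ).setPred m d α).setPred (n + m) s σ :=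
    Assignment.ext rfl (Function.update_comm hne.symm _ _ _).symm
  refine ⟨α, ?_, ?_⟩
  · refine (holds_allTuple hy _ _).2 fun η => ?_
    rw [hcomm]
    have h1 : ∀ k, Function.extend y η (Function.extend x ξ f.ind) (Fin.append x y k) =
        Fin.append ξ η k := by
      intro k
      refine Fin.addCases (fun i => ?_) (fun j => ?_) k
      · rw [Fin.append_left, Fin.append_left, Function.extend_apply', hx.extend_apply]
        rintro ⟨j, hj⟩
        exact hxy i j hj.symm
      · rw [Fin.append_right, Fin.append_right, hy.extend_apply]
    have h2 : (fun k => Function.extend y η (Function.extend x ξ f.ind) (y k)) = η :=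
      funext fun k => hy.extend_apply _ _ _
    show (Function.update (Function.update f.pred (m, d) α) (n + m, s) σ (m, d)).1
        (fun k => Function.extend y η (Function.extend x ξ f.ind) (y k)) ↔
      (Function.update (Function.update f.pred (m, d) α) (n + m, s) σ (n + m, s)).1
        (fun k => Function.extend y η (Function.extend x ξ f.ind) (Fin.append x y k))
    rw [Function.update_of_ne hne.symm, Function.update_self, Function.update_self, h2]
    exact (hα η).trans (iff_of_eq (congrArg σ.1 (funext h1).symm))
  · rw [hcomm]
    exact (holds_setPred_of_not_occursPred hS _ _).2 hH

theorem not_holds_WO1 (f : Assignment (fraenkelModel I)) :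
    ¬ Holds (fraenkelModel I) WO1 f := by
  classical
  intro h
  obtain ⟨T, ⟨-, hanti, -, -⟩, hleast⟩ := h
    ⟨fun _ => True, mem_fraenkelModel_iff.2 ⟨∅, fun _ _ => rfl⟩⟩
  obtain ⟨P, hP⟩ := mem_fraenkelModel_iff.1 T.2
  -- The complement of a support of `T` is itself in the model, and it is non-empty because `I` is
  -- infinite.
  let B : (fraenkelModel I).J 1 :=
    ⟨fun ξ => ξ 0 ∉ P, mem_fraenkelModel_iff.2 ⟨P, supportedBy_notMem P 0⟩⟩
  obtain ⟨a, ha⟩ := Infinite.exists_notMem_finset P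
  obtain ⟨b, hb, hbl⟩ := hleast B ⟨⟨a, ha⟩, fun _ _ => trivial⟩
  change I at b
  have hb : b ∉ P := hb
  obtain ⟨c, hc⟩ := Infinite.exists_notMem_finset (insert b P)
  rw [Finset.mem_insert, not_or] at hc
  have hbc : T.1 (![b, c] : Fin 2 → I) := by
    have h1 := hbl c hc.2
    refine cast (congrArg T.1 ?_) h1
    funext l; fin_cases l <;> rfl
  -- Both `b` and `c` lie outside `P`, so the transposition of the two fixes `P` and leaves `T`
  -- unchanged.
  have hcb : T.1 (![c, b] : Fin 2 → I) := by
    have h1 := hP (Equiv.swap b c) fun p hp => Equiv.swap_apply_of_ne_of_ne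
      (by rintro rfl; exact hb hp) (by rintro rfl; exact hc.2 hp)
    rw [← h1]
    have h2 : (fun l => (Equiv.swap b c)⁻¹ ((![c, b] : Fin 2 → I) l)) = ![b, c] := by
      funext l; fin_cases l <;> simp
    exact cast (congrArg T.1 h2.symm) hbc
  refine hc.1 ((hanti b c ⟨trivial, trivial⟩ ⟨?_, ?_⟩).symm)
  · refine cast (congrArg T.1 ?_) hbc
    funext l; fin_cases l <;> rfl
  · refine cast (congrArg T.1 ?_) hcb
    funext l; fin_cases l <;> rfl

end Infinite

end HPL

theorem proposition4 (I : Type*) [Infinite I] :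
    HPL.IsHenkinAsser (HPL.fraenkelModel I) ∧
    ∀ n m : ℕ+, HPL.Models (HPL.fraenkelModel I)
      (HPL.hax2 ∪ HPL.choiceH n m ∪ {HPL.Formula.neg HPL.WO1}) := by
  refine ⟨HPL.isHenkinAsser_fraenkelModel, fun n m => ?_⟩
  rintro H (((((h | h) | h) | h) | h) | rfl) f
  · exact HPL.models_axa H h f
  · exact HPL.models_axi H h f
  · exact HPL.models_ext H h f
  · exact HPL.isHenkinAsser_fraenkelModel H h f
  · exact HPL.models_choiceH n m H h f
  · exact HPL.not_holds_WO1 f
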